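/- Let $n\ge 0$ be an integer and let $K\subset\mathbb{R}^{n+1}$ be a smooth, strictly convex body with the origin in its interior. That is, $K$ is compact and convex, its support function $h(x)=\max_{y\in K}\langle x,y\rangle$ is smooth on the unit sphere $\mathbb{S}^n$, and $\bar\nabla^2h+\bar g\,h$ is positive definite at every point of $\mathbb{S}^n$, where $\bar g$ is the round metric of $\mathbb{S}^n$ and $\bar\nabla$ its Levi-Civita connection. Let $\theta$ be the spherical Lebesgue measure on $\mathbb{S}^n$, let the Gauss curvature $\mathcal{K}$ of $K$, as a function of the outward unit normal $x\in\mathbb{S}^n$, be given by \[ \frac{1}{\mathcal{K}}=\frac{\det(\bar\nabla^2h+\bar g\,h)}{\det\bar g}, \] and let $dV=\frac{h}{\mathcal{K}}\,d\theta$ (so that $\frac1{n+1}V$ is the cone-volume measure of $K$). Let $p\in\mathbb{R}$ with $p\ne-(n+1)$. If $dV=h^p\,d\theta$ (equivalently, $\mathcal{K}=h^{1-p}$ on $\mathbb{S}^n$), then $x\otimes x$ is $V$-integrable and \[ \int_{\mathbb{S}^n}x\otimes x\,dV(x)=\Big(\frac{1}{n+1}\int_{\mathbb{S}^n}dV\Big)\mathrm{Id},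 \] where $x\otimes x$ denotes the linear map $w\mapsto\langle x,w\rangle x$ of $\mathbb{R}^{n+1}$. -/

import Mathlib

open MeasureTheory
open scoped ContDiff InnerProductSpace

noncomputable section

namespace ConvexBodyGeometry

section Definitions

variable {E : Type*} [NormedAddCommGroup E] [InnerProductSpace ℝ E]

/-- The support function `h_K(x) = max {⟪x, y⟫ : y ∈ K}`, as a function on the whole space (the
`1`-homogeneous extension of its restriction to the unit sphere). -/
def supportFunction (K : Set E) (x : E) : ℝ :=
  sSup ((fun y => ⟪x, y⟫_ℝ) '' K)

/-- The extension of `f` restricted to the unit sphere which is constant on open rays. -/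
def radialExtension (f : E → ℝ) (y : E) : ℝ :=
  f (‖y‖⁻¹ • y)

/-- The tangent space `x^⊥` of the unit sphere at the unit vector `x`. -/
abbrev tangent (x : E) : Submodule ℝ E := (ℝ ∙ x)ᗮ

/-- The Hessian `∇̄² f (u, v)` at the unit vector `x`, for the Levi-Civita connection of the round
unit sphere, of the restriction of `f` to the sphere. For tangent vectors `u, v` it is the Euclidean
Hessian at `x` of the radially constant extension: the two differ by the derivative of the extension
in the direction of the second fundamental form `-⟪u, v⟫ x`, which is zero as `x` is radial. -/
def sphereHessian (f : E → ℝ) (x : E) (u v : tangent x) : ℝ :=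
  fderiv ℝ (fderiv ℝ (radialExtension f)) x (u : E) (v : E)

/-- The symmetric bilinear form `∇̄² h_K + h_K ḡ` on the tangent space of the sphere at `x`. -/
def curvatureForm (K : Set E) (x : E) (u v : tangent x) : ℝ :=
  sphereHessian (supportFunction K) x u v + supportFunction K x * ⟪u, v⟫_ℝ

/-- A smooth, strictly convex body: a compact convex set with non-empty interior whose support
function is smooth away from the origin (equivalently, smooth on the unit sphere) and has
`∇̄² h_K + h_K ḡ` positive definite, that is, all principal radii of curvature are positive. -/
structure IsSmoothStrictlyConvexBody (K : Set E) : Prop where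
  isCompact : IsCompact K
  convex : Convex ℝ K
  nonempty_interior : (interior K).Nonempty
  smooth : ContDiffOn ℝ ∞ (supportFunction K) {0}ᶜ
  posDef : ∀ x : E, ‖x‖ = 1 → ∀ u : tangent x, u ≠ 0 → 0 < curvatureForm K x u u

variable [FiniteDimensional ℝ E]

/-- The Gauss curvature of `K` at the boundary point with outward unit normal `x`, given by
`1 / 𝒦 = det (∇̄² h_K + h_K ḡ) / det ḡ`. The determinants are taken in an orthonormal basis of the
tangent space, so that `det ḡ = 1`; the quotient does not depend on the basis. -/
def gaussCurvature (K : Set E) (x : E) : ℝ :=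
  let b := stdOrthonormalBasis ℝ (tangent x)
  ((Matrix.of fun i j => curvatureForm K x (b i) (b j)).det)⁻¹

variable [MeasurableSpace E] [BorelSpace E]

variable (E) in
/-- The spherical Lebesgue measure `θ` on the unit sphere. -/
def sphereMeasure : Measure (Metric.sphere (0 : E) 1) :=
  (volume : Measure E).toSphere

/-- The measure `dV_K = (h_K / 𝒦_K) dθ` on the unit sphere, which is `dim E` times the cone-volume
measure of `K`. -/
def weightedConeMeasure (K : Set E) : Measure (Metric.sphere (0 : E) 1) :=
  (sphereMeasure E).withDensity fun x =>
    ENNReal.ofReal (supportFunction K x / gaussCurvature K x)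

end Definitions

end ConvexBodyGeometry

end

/-! Write `d = n + 1`. The argument compares two instances of the divergence theorem and involves no
curvature estimates. The map `Ψ x = ‖x‖ ∇h x` sends a unit normal to its boundary point, and `det DΨ
= h / 𝒦` on the sphere. If `tr A = 0`, the Piola identity makes the cofactor field `det DΨ • DΨ⁻¹ A
Ψ` divergence-free. This gives `∫ 𝒦⁻¹ ⟪x, A ∇h⟫ dθ = 0`, which is the divergence theorem on `K` for
the field `y ↦ A y`, transported to the normals (`integral_inv_gaussCurvature_mul`). If `tr B = 0`,
integrating the divergence of `h ^ p • B x` gives `p ∫ h ^ (p - 1) dh(B x) dθ = (d + p) ∫ h ^ p ⟪x,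
B x⟫ dθ` (`integral_rpow_mul_inner`). The hypothesis says `𝒦⁻¹ = h ^ (p - 1)`, so with `A` the
adjoint of `B` the left side of the second identity vanishes by the first. As `d + p ≠ 0`, the
second moments of `h ^ p dθ = dV` vanish on all trace-free operators, so the moment operator is a
multiple of the identity, and `‖x‖ = 1` fixes the multiple. -/

namespace ConvexBodyGeometry

/-! ### Divergence theorem on the sphere, by homogeneity and a radial cutoff -/

section Divergence

open Module Set

variable {E : Type*} [NormedAddCommGroup E] [InnerProductSpace ℝ E]

/-- The divergence of a vector field. -/
noncomputable def divergence (Y : E → E) (x : E) : ℝ :=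
  LinearMap.trace ℝ E (fderiv ℝ Y x)

theorem hasFDerivAt_norm {x : E} (hx : x ≠ 0) :
    HasFDerivAt (fun y : E => ‖y‖) (‖x‖⁻¹ • innerSL ℝ x) x := by
  have h := (hasStrictFDerivAt_norm_sq x).hasFDerivAt.sqrt (by simpa using hx)
  simp only [Real.sqrt_sq (norm_nonneg _)] at h
  exact h.congr_fderiv (by ext v; simp [field])

theorem divergence_clm (A : E →L[ℝ] E) (x : E) :
    divergence A x = LinearMap.trace ℝ E A := by
  simp [divergence]

theorem fderiv_smul_of_homogeneous {F : Type*} [NormedAddCommGroup F] [NormedSpace ℝ F]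
    {Y : E → F} {c t : ℝ} (ht : t ≠ 0)
    (hY : ∀ x, x ≠ 0 → Y (t • x) = c • Y x) {x : E} (hx : x ≠ 0) :
    fderiv ℝ Y (t • x) = (t⁻¹ * c) • fderiv ℝ Y x := by
  have h1 := fderiv_comp_smul (𝕜 := ℝ) (f := Y) (x := x) t
  have h2 : (fun y => Y (t • y)) =ᶠ[nhds x] c • Y := by
    filter_upwards [isOpen_compl_singleton.mem_nhds hx] with y hy using hY y hy
  rw [h2.fderiv_eq, fderiv_const_smul_field] at h1
  rw [mul_smul, eq_comm, inv_smul_eq_iff₀ ht]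
  exact h1

/-- The cutoff vanishes near the origin and so hides the singularity of `G` there. -/
theorem continuous_radial_mul {φ : ℝ → ℝ} (hφ : Continuous φ) (h1 : ∀ t < 1, φ t = 0)
    {F : Type*} [NormedAddCommGroup F] [NormedSpace ℝ F]
    {G : E → F} (hG : ContinuousOn G {0}ᶜ) : Continuous fun x => φ ‖x‖ • G x := by
  rw [continuous_iff_continuousAt]
  intro x
  by_cases hx : x = 0
  · subst hx
    have : (fun x : E => φ ‖x‖ • G x) =ᶠ[nhds 0] fun _ => 0 := by
      filter_upwards [Metric.ball_mem_nhds (0 : E) one_pos] with y hy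
      rw [h1 _ (by simpa using hy), zero_smul]
    exact (continuousAt_const).congr this.symm
  · exact (hφ.continuousAt.comp continuous_norm.continuousAt).smul
      (hG.continuousAt (isOpen_compl_singleton.mem_nhds hx))

variable [FiniteDimensional ℝ E]

theorem continuous_trace : Continuous fun A : E →L[ℝ] E => LinearMap.trace ℝ E A :=
  ((LinearMap.trace ℝ E).comp
    (ContinuousLinearMap.coeLM ℝ : (E →L[ℝ] E) →ₗ[ℝ] E →ₗ[ℝ] E)).continuous_of_finiteDimensional

theorem trace_smulRight (φ : E →L[ℝ] ℝ) (v : E) :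
    LinearMap.trace ℝ E (φ.smulRight v : E →L[ℝ] E) = φ v := by
  have : ((φ.smulRight v : E →L[ℝ] E) : E →ₗ[ℝ] E) = (φ : E →ₗ[ℝ] ℝ).smulRight v := by
    ext; simp
  rw [this, LinearMap.trace_smulRight]; rfl

theorem divergence_smul {f : E → ℝ} {Y : E → E} {x : E} (hf : DifferentiableAt ℝ f x)
    (hY : DifferentiableAt ℝ Y x) :
    divergence (fun y => f y • Y y) x = f x * divergence Y x + fderiv ℝ f x (Y x) := by
  unfold divergence
  rw [fderiv_fun_smul hf hY]
  simp only [ContinuousLinearMap.toLinearMap_add, ContinuousLinearMap.toLinearMap_smul, map_add, map_smul,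
    trace_smulRight, smul_eq_mul]

theorem divergence_smul_of_homogeneous {Y : E → E} {c t : ℝ} (ht : t ≠ 0)
    (hY : ∀ x, x ≠ 0 → Y (t • x) = c • Y x) {x : E} (hx : x ≠ 0) :
    divergence Y (t • x) = t⁻¹ * (c * divergence Y x) := by
  simp [divergence, fderiv_smul_of_homogeneous ht hY hx, mul_assoc]

theorem hasCompactSupport_radial_mul {φ : ℝ → ℝ} (h3 : ∀ t, 3 < t → φ t = 0)
    {F : Type*} [NormedAddCommGroup F] [NormedSpace ℝ F]
    (G : E → F) : HasCompactSupport fun x => φ ‖x‖ • G x := by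
  refine HasCompactSupport.intro (isCompact_closedBall (0 : E) 3) fun x hx => ?_
  rw [h3 _ (by simpa using hx), zero_smul]

variable [MeasurableSpace E] [BorelSpace E]

theorem integral_fderiv_apply_eq_zero {f : E → ℝ} (hf : ContDiff ℝ 1 f)
    (hc : HasCompactSupport f) (v : E) : ∫ x, fderiv ℝ f x v = 0 := by
  have h := integral_mul_fderiv_eq_neg_fderiv_mul_of_integrable (μ := (volume : Measure E))
    (f := fun _ => (1 : ℝ)) (g := f) (v := v) (by simp)
    (by
      simp only [one_mul]
      exact ((hf.continuous_fderiv one_ne_zero).clm_apply continuous_const).integrable_of_hasCompactSupport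
        (hc.fderiv_apply (𝕜 := ℝ) v))
    (by simpa using hf.continuous.integrable_of_hasCompactSupport hc)
    (fun _ _ => differentiableAt_const _)
    (fun x _ => (hf.differentiable one_ne_zero) x)
  simpa using h

theorem integral_divergence_eq_zero {Z : E → E} (hZ : ContDiff ℝ 1 Z)
    (hc : HasCompactSupport Z) : ∫ x, divergence Z x = 0 := by
  let b := stdOrthonormalBasis ℝ E
  have hd : ∀ x i, fderiv ℝ (fun y => ⟪b i, Z y⟫_ℝ) x (b i) = ⟪b i, fderiv ℝ Z x (b i)⟫_ℝ := by
    intro x i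
    have := (((innerSL ℝ (b i)).hasFDerivAt (x := Z x)).comp x
      (hZ.differentiable one_ne_zero x).hasFDerivAt).fderiv
    simp only [Function.comp_def, innerSL_apply_apply] at this
    rw [this]; simp
  have hcd : ∀ i, ContDiff ℝ 1 fun y => ⟪b i, Z y⟫_ℝ := fun i => contDiff_const.inner ℝ hZ
  have hcs : ∀ i, HasCompactSupport fun y => ⟪b i, Z y⟫_ℝ := fun i =>
    hc.comp_left (g := fun z => ⟪b i, z⟫_ℝ) (by simp)
  have : ∀ x, divergence Z x = ∑ i, fderiv ℝ (fun y => ⟪b i, Z y⟫_ℝ) x (b i) := by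
    intro x
    rw [divergence, LinearMap.trace_eq_sum_inner _ b]
    exact Finset.sum_congr rfl fun i _ => (hd x i).symm
  simp_rw [this]
  rw [integral_finsetSum]
  · exact Finset.sum_eq_zero fun i _ => integral_fderiv_apply_eq_zero (hcd i) (hcs i) _
  · intro i _
    exact (((hcd i).continuous_fderiv one_ne_zero).clm_apply
      continuous_const).integrable_of_hasCompactSupport ((hcs i).fderiv_apply (𝕜 := ℝ) _)

/-- Integration in polar coordinates of a function which separates the variables. -/
theorem integral_eq_mul_integral_sphere [Nontrivial E] {F : E → ℝ} {a : ℝ → ℝ} {b : E → ℝ}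
    (hF : ∀ t : ℝ, 0 < t → ∀ x : E, ‖x‖ = 1 → F (t • x) = a t * b x) :
    ∫ x, F x = (∫ t in Ioi (0 : ℝ), t ^ (finrank ℝ E - 1) * a t) *
      ∫ x : Metric.sphere (0 : E) 1, b x ∂sphereMeasure E := by
  have hmp := (volume : Measure E).measurePreserving_homeomorphUnitSphereProd
  calc ∫ x, F x = ∫ x : ({(0)}ᶜ : Set E), F x ∂((volume : Measure E).comap (↑)) := by
        rw [integral_subtype_comap (measurableSet_singleton _).compl F, restrict_compl_singleton]
    _ = ∫ z : Metric.sphere (0 : E) 1 × Ioi (0 : ℝ), b z.1 * a z.2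
          ∂((volume : Measure E).toSphere.prod (.volumeIoiPow (finrank ℝ E - 1))) := by
        rw [← hmp.integral_comp (Homeomorph.measurableEmbedding _)]
        refine integral_congr_ae (.of_forall fun x => ?_)
        have hx : (x : E) ≠ 0 := x.2
        have h := hF ‖(x : E)‖ (norm_pos_iff.2 hx) (‖(x : E)‖⁻¹ • (x : E))
          (by rw [norm_smul, norm_inv, norm_norm, inv_mul_cancel₀ (norm_ne_zero_iff.2 hx)])
        rw [smul_smul, mul_inv_cancel₀ (norm_ne_zero_iff.2 hx), one_smul] at h
        simp only [homeomorphUnitSphereProd_apply_snd_coe, homeomorphUnitSphereProd_apply_fst_coe]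
        rw [h, mul_comm]
    _ = (∫ x : Metric.sphere (0 : E) 1, b x ∂sphereMeasure E) *
          ∫ t : Ioi (0 : ℝ), a t ∂.volumeIoiPow (finrank ℝ E - 1) :=
        integral_prod_mul (fun x : Metric.sphere (0 : E) 1 => b x) (fun t : Ioi (0 : ℝ) => a t)
    _ = _ := by
        rw [mul_comm]
        congr 1
        simp only [Measure.volumeIoiPow, ENNReal.ofReal]
        rw [integral_withDensity_eq_integral_smul (by fun_prop),
          integral_subtype_comap measurableSet_Ioi fun t ↦ Real.toNNReal (t ^ (finrank ℝ E - 1)) • a t]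
        refine setIntegral_congr_fun measurableSet_Ioi fun t ht => ?_
        rw [NNReal.smul_def, Real.coe_toNNReal _ (pow_nonneg (le_of_lt ht) _), smul_eq_mul]

/-- A bump centred at `2` with outer radius `1`. Its positive integral is the radial factor to be
divided out at the end of the divergence theorem. -/
theorem exists_radial_cutoff : ∃ β : ℝ → ℝ, ContDiff ℝ ∞ β ∧ (∀ t, t ≤ 1 → β t = 0) ∧
    (∀ t, 3 ≤ t → β t = 0) ∧ 0 < ∫ t in Ioi (0 : ℝ), β t := by
  let f : ContDiffBump (2 : ℝ) := ⟨1 / 2, 1, by norm_num, by norm_num⟩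
  have hz : ∀ t, 1 ≤ |t - 2| → f t = 0 := fun t ht => f.zero_of_le_dist (by simpa [Real.dist_eq])
  refine ⟨f, f.contDiff, fun t ht => hz t ?_, fun t ht => hz t ?_, ?_⟩
  · rw [abs_sub_comm]; exact le_trans (by linarith) (le_abs_self _)
  · exact le_trans (by linarith) (le_abs_self _)
  · rw [setIntegral_eq_integral_of_forall_compl_eq_zero]
    · exact f.integral_pos
    · intro t ht
      refine hz t ?_
      simp only [mem_Ioi, not_lt] at ht
      rw [abs_sub_comm]; exact le_trans (by linarith) (le_abs_self _)

/-- The divergence theorem on the sphere for fields which are homogeneous of degree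
`1 - dim E`. -/
theorem integral_sphere_divergence_eq_zero [Nontrivial E] {Y : E → E}
    (hY : ContDiffOn ℝ 1 Y {0}ᶜ)
    (hom : ∀ t : ℝ, 0 < t → ∀ x : E, x ≠ 0 → Y (t • x) = (t ^ (finrank ℝ E - 1))⁻¹ • Y x) :
    ∫ x : Metric.sphere (0 : E) 1, divergence Y x ∂sphereMeasure E = 0 := by
  obtain ⟨β, hβ, hβ1, hβ3, hβpos⟩ := exists_radial_cutoff
  -- The divergence of `Y` has degree `-d`, one less than `Y`; the extra factor `t` makes the radial
  -- integral of the `div Y` term exactly `∫ β`. The other term carries `χ'`, whose integral is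
  -- zero.
  set χ : ℝ → ℝ := fun t => t * β t with hχdef
  have hχ : ContDiff ℝ ∞ χ := contDiff_id.mul hβ
  have hχ1 : ∀ t, t ≤ 1 → χ t = 0 := fun t ht => by simp [hχdef, hβ1 t ht]
  have hχ3 : ∀ t, 3 ≤ t → χ t = 0 := fun t ht => by simp [hχdef, hβ3 t ht]
  have hχc : HasCompactSupport χ := by
    refine HasCompactSupport.intro (isCompact_Icc (a := (1 : ℝ)) (b := 3)) fun t ht => ?_
    by_contra h
    refine ht ⟨?_, ?_⟩
    · by_contra h'; exact h (hχ1 t (le_of_not_ge h'))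
    · by_contra h'; exact h (hχ3 t (le_of_not_ge h'))
  have hχ'c : Continuous (deriv χ) := hχ.continuous_deriv (by simp)
  have hχ'1 : ∀ t, t < 1 → deriv χ t = 0 := fun t ht => by
    have : χ =ᶠ[nhds t] fun _ => 0 := by
      filter_upwards [Iio_mem_nhds ht] with s hs using hχ1 s (le_of_lt hs)
    rw [this.deriv_eq]; simp
  have hχ'3 : ∀ t, 3 < t → deriv χ t = 0 := fun t ht => by
    have : χ =ᶠ[nhds t] fun _ => 0 := by
      filter_upwards [Ioi_mem_nhds ht] with s hs using hχ3 s (le_of_lt hs)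
    rw [this.deriv_eq]; simp
  have hYat : ∀ x : E, x ≠ 0 → ContDiffAt ℝ 1 Y x := fun x hx =>
    hY.contDiffAt (isOpen_compl_singleton.mem_nhds hx)
  have hYd : ∀ x : E, x ≠ 0 → DifferentiableAt ℝ Y x := fun x hx =>
    (hYat x hx).differentiableAt one_ne_zero
  have hdivY : ContinuousOn (divergence Y) {0}ᶜ := by
    have := hY.continuousOn_fderiv_of_isOpen isOpen_compl_singleton le_rfl
    exact continuous_trace.comp_continuousOn this
  have hZ : ContDiff ℝ 1 fun x => χ ‖x‖ • Y x := by
    rw [contDiff_iff_contDiffAt]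
    intro x
    by_cases hx : x = 0
    · subst hx
      have : (fun x : E => χ ‖x‖ • Y x) =ᶠ[nhds 0] fun _ => 0 := by
        filter_upwards [Metric.ball_mem_nhds (0 : E) one_pos] with y hy
        rw [hχ1 _ (by simpa using (le_of_lt (by simpa using hy))), zero_smul]
      exact contDiffAt_const.congr_of_eventuallyEq this
    · exact ((hχ.of_le (by simp)).contDiffAt.comp x (contDiffAt_norm ℝ hx)).smul (hYat x hx)
  have hZ0 := integral_divergence_eq_zero hZ
    (hasCompactSupport_radial_mul (fun t ht => hχ3 t ht.le) Y)
  set F₁ : E → ℝ := fun x => deriv χ ‖x‖ • (‖x‖⁻¹ * ⟪x, Y x⟫_ℝ) with hF₁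
  set F₂ : E → ℝ := fun x => χ ‖x‖ • divergence Y x with hF₂
  have hdec : ∀ᵐ x : E, divergence (fun x => χ ‖x‖ • Y x) x = F₁ x + F₂ x := by
    filter_upwards [compl_mem_ae_iff.2 (measure_singleton (0 : E))] with x hx
    have hn : HasFDerivAt (fun y : E => χ ‖y‖)
        (deriv χ ‖x‖ • (‖x‖⁻¹ • innerSL ℝ x)) x := by
      exact ((hχ.differentiable (by simp) ‖x‖).hasDerivAt).comp_hasFDerivAt x (hasFDerivAt_norm hx)
    rw [divergence_smul hn.differentiableAt (hYd x hx), hn.fderiv, hF₁, hF₂]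
    simp
    ring
  have hF₁i : Integrable F₁ := by
    refine (continuous_radial_mul hχ'c hχ'1 ?_).integrable_of_hasCompactSupport
      (hasCompactSupport_radial_mul hχ'3 _)
    exact (continuous_norm.continuousOn.inv₀ (fun x hx => norm_ne_zero_iff.2 hx)).mul
      (continuousOn_id.inner hY.continuousOn)
  have hF₂i : Integrable F₂ :=
    (continuous_radial_mul hχ.continuous (fun t ht => hχ1 t ht.le)
      hdivY).integrable_of_hasCompactSupport
      (hasCompactSupport_radial_mul (fun t ht => hχ3 t ht.le) _)
  rw [integral_congr_ae hdec, integral_add hF₁i hF₂i] at hZ0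
  have e₁ := integral_eq_mul_integral_sphere (F := F₁)
    (a := fun t => deriv χ t * (t ^ (finrank ℝ E - 1))⁻¹) (b := fun x => ⟪x, Y x⟫_ℝ) (by
      intro t ht x hx
      simp only [hF₁, hom t ht x (ne_zero_of_norm_ne_zero (by simp [hx])), norm_smul, hx, inner_smul_left, inner_smul_right, Real.norm_eq_abs,
        abs_of_pos ht, mul_one, smul_eq_mul, RCLike.conj_to_real]
      field_simp)
  have e₂ := integral_eq_mul_integral_sphere (F := F₂)
    (a := fun t => β t * (t ^ (finrank ℝ E - 1))⁻¹) (b := divergence Y) (by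
      intro t ht x hx
      simp only [hF₂, divergence_smul_of_homogeneous ht.ne' (hom t ht)
        (ne_zero_of_norm_ne_zero (a := x) (by simp [hx])), norm_smul, hx,
        Real.norm_eq_abs, abs_of_pos ht, mul_one, smul_eq_mul, hχdef]
      field_simp)
  have i₁ : ∫ t in Ioi (0 : ℝ), t ^ (finrank ℝ E - 1) *
      (deriv χ t * (t ^ (finrank ℝ E - 1))⁻¹) = 0 := by
    calc _ = ∫ t in Ioi (0 : ℝ), deriv χ t := by
          refine setIntegral_congr_fun measurableSet_Ioi fun t ht => ?_
          have : t ^ (finrank ℝ E - 1) ≠ 0 := pow_ne_zero _ (ne_of_gt ht)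
          field_simp
      _ = 0 := by
          rw [hχc.integral_Ioi_deriv_eq (hχ.of_le (by simp)), hχ1 0 zero_le_one, neg_zero]
  have i₂ : ∫ t in Ioi (0 : ℝ), t ^ (finrank ℝ E - 1) *
      (β t * (t ^ (finrank ℝ E - 1))⁻¹) = ∫ t in Ioi (0 : ℝ), β t := by
    refine setIntegral_congr_fun measurableSet_Ioi fun t ht => ?_
    have : t ^ (finrank ℝ E - 1) ≠ 0 := pow_ne_zero _ (ne_of_gt ht)
    field_simp
  rw [e₁, e₂, i₁, i₂, zero_mul, zero_add] at hZ0
  exact (mul_eq_zero.1 hZ0).resolve_left hβpos.ne'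

end Divergence

/-! ### Jacobi's formula and the Piola identity -/

section Piola

open Module Set

variable {E : Type*} [NormedAddCommGroup E] [InnerProductSpace ℝ E] [FiniteDimensional ℝ E]

theorem contDiff_det {m : WithTop ℕ∞} : ContDiff ℝ m fun A : E →L[ℝ] E => A.det := by
  let b := finBasis ℝ E
  have h : ∀ A : E →L[ℝ] E, A.det = ∑ σ : Equiv.Perm (Fin (finrank ℝ E)),
      (Equiv.Perm.sign σ : ℝ) * ∏ i, b.repr (A (b i)) (σ i) := by
    intro A
    rw [ContinuousLinearMap.det, ← LinearMap.det_toMatrix b, Matrix.det_apply']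
    simp [LinearMap.toMatrix_apply]
  simp_rw [h]
  refine ContDiff.sum fun σ _ => contDiff_const.mul (contDiff_prod fun i _ => ?_)
  exact (((b.coord (σ i)).toContinuousLinearMap).comp
    (ContinuousLinearMap.apply ℝ E (b i))).contDiff

theorem det_mul (A B : E →L[ℝ] E) : (A * B).det = A.det * B.det := by
  simp only [ContinuousLinearMap.det]
  exact LinearMap.det_comp _ _

theorem hasDerivAt_det_one_add_smul (N : E →L[ℝ] E) :
    HasDerivAt (fun t : ℝ => (1 + t • N).det) (LinearMap.trace ℝ E N) 0 := by
  let b := finBasis ℝ E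
  set P := LinearMap.toMatrix b b (N : E →ₗ[ℝ] E)
  have h : ∀ t : ℝ, (1 + t • N).det = (1 + t • P).det := by
    intro t
    rw [ContinuousLinearMap.det, ← LinearMap.det_toMatrix b]
    congr 1
    simp [P, LinearMap.toMatrix_one]
  refine HasDerivAt.congr_of_eventuallyEq ?_ (.of_forall fun t =>
    (h t).trans (Matrix.det_one_add_smul t P))
  rw [LinearMap.trace_eq_matrix_trace ℝ b]
  have h1 := ((hasDerivAt_id' (0 : ℝ)).const_mul P.trace).const_add 1
  -- The terms of order at least two in `det (1 + t P)`, as `t ^ 2` times a polynomial; they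
  -- contribute nothing to the derivative at `0`.
  have h2 := (((((1 : Matrix (Fin (finrank ℝ E)) (Fin (finrank ℝ E)) (Polynomial ℝ)) +
    (Polynomial.X : Polynomial ℝ) • P.map Polynomial.C).det.divX.divX).hasDerivAt 0).fun_mul
      ((hasDerivAt_id' (0 : ℝ)).fun_pow 2))
  convert h1.fun_add h2 using 1
  simp [P]

/-- **Jacobi's formula** at an invertible operator. -/
theorem fderiv_det_apply {M : E →L[ℝ] E} (hM : IsUnit M) (H : E →L[ℝ] E) :
    fderiv ℝ (fun A : E →L[ℝ] E => A.det) M H =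
      M.det * LinearMap.trace ℝ E (Ring.inverse M * H : E →L[ℝ] E) := by
  have hd : HasFDerivAt (fun A : E →L[ℝ] E => A.det) (fderiv ℝ (fun A : E →L[ℝ] E => A.det) M)
      (M + (0 : ℝ) • H) := by
    rw [zero_smul, add_zero]
    exact ((contDiff_det (m := 1)).differentiable one_ne_zero M).hasFDerivAt
  have hline : HasDerivAt (fun t : ℝ => M + t • H) H 0 := by
    simpa using ((hasDerivAt_id (0 : ℝ)).smul_const H).const_add M
  have h1 := hd.comp_hasDerivAt (0 : ℝ) hline
  have h2 := (hasDerivAt_det_one_add_smul (Ring.inverse M * H)).const_mul M.det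
  refine h1.unique (h2.congr_of_eventuallyEq (.of_forall fun t => ?_))
  simp only [Function.comp_def]
  rw [← det_mul, mul_add, mul_one, mul_smul_comm, ← mul_assoc, Ring.mul_inverse_cancel _ hM,
    one_mul]

/-- The cofactor field of `Ψ` in the direction `A ∘ Ψ`. -/
noncomputable def cofactorField (Ψ : E → E) (A : E →L[ℝ] E) (x : E) : E :=
  (fderiv ℝ Ψ x).det • Ring.inverse (fderiv ℝ Ψ x) (A (Ψ x))

theorem contDiffAt_cofactorField {Ψ : E → E} (A : E →L[ℝ] E) {x : E}
    (hΨ : ContDiffAt ℝ 2 Ψ x) (hM : IsUnit (fderiv ℝ Ψ x)) :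
    ContDiffAt ℝ 1 (cofactorField Ψ A) x := by
  have h1 : ContDiffAt ℝ 1 (fderiv ℝ Ψ) x := hΨ.fderiv_right (by norm_num)
  obtain ⟨u, hu⟩ := hM
  have h2 := contDiffAt_ringInverse ℝ (n := 1) u
  rw [hu] at h2
  exact (contDiff_det.contDiffAt.comp x h1).smul ((h2.comp x h1).clm_apply
    (A.contDiff.contDiffAt.comp x (hΨ.of_le (by norm_num))))

/-- The **Piola identity**. -/
theorem divergence_cofactorField {Ψ : E → E} (A : E →L[ℝ] E) {x : E}
    (hΨ : ContDiffAt ℝ 2 Ψ x) (hM : IsUnit (fderiv ℝ Ψ x)) :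
    divergence (cofactorField Ψ A) x = (fderiv ℝ Ψ x).det * LinearMap.trace ℝ E A := by
  have h1 : ContDiffAt ℝ 1 (fderiv ℝ Ψ) x := hΨ.fderiv_right (by norm_num)
  have hsymm : IsSymmSndFDerivAt ℝ Ψ x := hΨ.isSymmSndFDerivAt (by simp)
  set M := fderiv ℝ Ψ x with hMdef
  set M' := fderiv ℝ (fderiv ℝ Ψ) x
  have hM' : HasFDerivAt (fderiv ℝ Ψ) M' x := (h1.differentiableAt one_ne_zero).hasFDerivAt
  have hΨ' : HasFDerivAt Ψ M x := (hΨ.differentiableAt two_ne_zero).hasFDerivAt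
  set N := Ring.inverse M with hN
  set z := N (A (Ψ x)) with hz
  have hdet : HasFDerivAt (𝕜 := ℝ) (fun y => (fderiv ℝ Ψ y).det)
      ((fderiv ℝ (fun A : E →L[ℝ] E => A.det) M).comp M') x :=
    (((contDiff_det (m := 1)).differentiable one_ne_zero M).hasFDerivAt).comp x hM'
  have hinv : HasFDerivAt (fun y => Ring.inverse (fderiv ℝ Ψ y))
      ((-ContinuousLinearMap.mulLeftRight ℝ (E →L[ℝ] E) N N).comp M') x := by
    obtain ⟨u, hu⟩ := hM
    have h := hasFDerivAt_ringInverse (𝕜 := ℝ) u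
    rw [← Ring.inverse_unit, hu] at h
    exact h.comp x hM'
  have hvec := HasFDerivAt.clm_apply hinv ((A.hasFDerivAt (x := Ψ x)).comp x hΨ')
  have hdiff : DifferentiableAt ℝ (fun y => Ring.inverse (fderiv ℝ Ψ y) (A (Ψ y))) x :=
    hvec.differentiableAt
  -- Symmetry of `D²Ψ` turns `v ↦ M' v z` into the operator `M' z`. The trace of `N * M' z` then
  -- cancels against the derivative of the determinant in direction `z`, by Jacobi's formula.
  have key : fderiv ℝ (fun y => Ring.inverse (fderiv ℝ Ψ y) (A (Ψ y))) x =
      N * A * M - N * M' z := by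
    refine (hvec.fderiv).trans ?_
    ext v
    simp only [Function.comp_def, ← hMdef, ← hN, add_apply,
      ContinuousLinearMap.flip_apply, ContinuousLinearMap.comp_apply,
      neg_apply, ContinuousLinearMap.mulLeftRight_apply,
      sub_apply]
    rw [← sub_eq_add_neg]
    exact congrArg (fun w => N (A (M v)) - N w) (hsymm v z)
  have hcof : cofactorField Ψ A = fun y => (fderiv ℝ Ψ y).det •
      (Ring.inverse (fderiv ℝ Ψ y) (A (Ψ y))) := rfl
  rw [hcof, divergence_smul hdet.differentiableAt hdiff, hdet.fderiv, divergence, key]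
  have hcyc : LinearMap.trace ℝ E ((N * A * M : E →L[ℝ] E) : E →ₗ[ℝ] E) =
      LinearMap.trace ℝ E (A : E →ₗ[ℝ] E) := by
    have h := LinearMap.trace_mul_comm ℝ ((N * A : E →L[ℝ] E) : E →ₗ[ℝ] E) (M : E →ₗ[ℝ] E)
    refine h.trans ?_
    have : M * (N * A) = A := by rw [← mul_assoc, hN, Ring.mul_inverse_cancel _ hM, one_mul]
    exact congrArg (fun B : E →L[ℝ] E => LinearMap.trace ℝ E (B : E →ₗ[ℝ] E)) this
  simp only [ContinuousLinearMap.coe_comp, Function.comp_apply, fderiv_det_apply hM,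
    ContinuousLinearMap.toLinearMap_sub, map_sub, hcyc]
  simp only [← hN, ← hz, ← hMdef]
  ring

end Piola

/-! ### Calculus of 1-homogeneous functions and the normal map -/

section Homogeneous

open Module Set

variable {E : Type*} [NormedAddCommGroup E] [InnerProductSpace ℝ E]

theorem two_le_infty : (2 : WithTop ℕ∞) ≤ ∞ :=
  WithTop.coe_le_coe.2 (le_top : (2 : ℕ∞) ≤ ⊤)

/-- Euler's relation. -/
theorem fderiv_apply_self_of_homogeneous {F : Type*} [NormedAddCommGroup F] [NormedSpace ℝ F]
    {f : E → F} {a : ℝ → ℝ} {a' : ℝ} {x : E} (hf : DifferentiableAt ℝ f x)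
    (ha : HasDerivAt a a' 1) (hom : ∀ t : ℝ, 0 < t → f (t • x) = a t • f x) :
    fderiv ℝ f x x = a' • f x := by
  have hline : HasDerivAt (fun t : ℝ => t • x) x 1 := by
    simpa using (hasDerivAt_id (1 : ℝ)).smul_const x
  have hf' : HasFDerivAt f (fderiv ℝ f x) ((1 : ℝ) • x) := by
    rw [one_smul]; exact hf.hasFDerivAt
  refine (hf'.comp_hasDerivAt (1 : ℝ) hline).unique
    ((ha.smul_const (f x)).congr_of_eventuallyEq ?_)
  filter_upwards [Ioi_mem_nhds (zero_lt_one (α := ℝ))] with t ht using hom t ht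

theorem fderiv_norm_rpow_apply (q : ℝ) {x : E} (hx : ‖x‖ = 1) (v : E) :
    fderiv ℝ (fun y : E => ‖y‖ ^ q) x v = q * ⟪x, v⟫_ℝ := by
  have h0 : x ≠ 0 := ne_zero_of_norm_ne_zero (by simp [hx])
  rw [((hasFDerivAt_norm h0).rpow_const (p := q) (Or.inl (by simp [hx]))).fderiv]
  simp [hx]

theorem contDiffAt_norm_rpow (q : ℝ) {m : WithTop ℕ∞} {x : E} (hx : x ≠ 0) :
    ContDiffAt ℝ m (fun y : E => ‖y‖ ^ q) x :=
  (contDiffAt_norm ℝ hx).rpow_const_of_ne (norm_ne_zero_iff.2 hx)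

variable {h : E → ℝ}

theorem contDiffAt_of_smooth (hsm : ContDiffOn ℝ ∞ h {0}ᶜ) {x : E} (hx : x ≠ 0) :
    ContDiffAt ℝ ∞ h x :=
  hsm.contDiffAt (isOpen_compl_singleton.mem_nhds hx)

theorem contDiffAt_fderiv_of_smooth (hsm : ContDiffOn ℝ ∞ h {0}ᶜ) {x : E} (hx : x ≠ 0) :
    ContDiffAt ℝ ∞ (fderiv ℝ h) x :=
  (contDiffAt_of_smooth hsm hx).fderiv_right (by simp)

/-- The radial extension is `‖y‖⁻¹ h y`. In its second derivative every term containing `⟪x, u⟫` or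
`⟪x, v⟫` drops out, and differentiating the factor `y` in `-‖y‖⁻³ h y • y` leaves `-h ⟪u, v⟫`. Hence
`∇̄²h + h ḡ` is the Euclidean Hessian of `h` on `x^⊥`. -/
theorem sphereHessian_eq (hsm : ContDiffOn ℝ ∞ h {0}ᶜ)
    (hom : ∀ t : ℝ, 0 < t → ∀ x, h (t • x) = t * h x) {x : E} (hx : ‖x‖ = 1) (u v : tangent x) :
    sphereHessian h x u v =
      fderiv ℝ (fderiv ℝ h) x (u : E) (v : E) - h x * ⟪u, v⟫_ℝ := by
  have h0 : x ≠ 0 := ne_zero_of_norm_ne_zero (by simp [hx])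
  have hu : ⟪x, (u : E)⟫_ℝ = 0 := Submodule.mem_orthogonal_singleton_iff_inner_right.1 u.2
  have hv : ⟪x, (v : E)⟫_ℝ = 0 := Submodule.mem_orthogonal_singleton_iff_inner_right.1 v.2
  have hU : ∀ᶠ y in nhds x, y ≠ 0 := isOpen_compl_singleton.mem_nhds h0
  have e₁ : ∀ y : E, y ≠ 0 → radialExtension h =ᶠ[nhds y] fun z => ‖z‖ ^ (-1 : ℝ) * h z := by
    intro y hy
    filter_upwards [isOpen_compl_singleton.mem_nhds hy] with z hz
    rw [radialExtension, hom _ (inv_pos.2 (norm_pos_iff.2 hz)), Real.rpow_neg_one]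
  have e₂ : fderiv ℝ (radialExtension h) =ᶠ[nhds x] fun y =>
      ‖y‖ ^ (-1 : ℝ) • fderiv ℝ h y + (-‖y‖ ^ (-3 : ℝ) * h y) • innerSL ℝ y := by
    filter_upwards [hU] with y hy
    have hn := (hasFDerivAt_norm hy).rpow_const (p := -1) (Or.inl (norm_ne_zero_iff.2 hy))
    rw [(e₁ y hy).fderiv_eq, (hn.fun_mul ((contDiffAt_of_smooth hsm hy).differentiableAt
      (by simp)).hasFDerivAt).fderiv]
    congr 1
    rw [smul_smul, smul_smul]
    congr 1
    have hy' : 0 < ‖y‖ := norm_pos_iff.2 hy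
    rw [show (-3 : ℝ) = -1 - 1 - 1 by norm_num, Real.rpow_sub_one hy'.ne' (-1 - 1)]
    field_simp
  have d₁ : HasFDerivAt (fun y : E => ‖y‖ ^ (-1 : ℝ)) _ x :=
    (hasFDerivAt_norm h0).rpow_const (p := -1) (Or.inl (by simp [hx]))
  have d₂ := ((contDiffAt_fderiv_of_smooth hsm h0).differentiableAt (by simp)).hasFDerivAt
  have d₃ : DifferentiableAt ℝ (fun y : E => -‖y‖ ^ (-3 : ℝ) * h y) x :=
    (((contDiffAt_norm_rpow (-3) (m := 1) h0).differentiableAt one_ne_zero).neg).mul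
      ((contDiffAt_of_smooth hsm h0).differentiableAt (by simp))
  have d₄ : HasFDerivAt (fun y : E => innerSL ℝ y) (innerSL ℝ) x :=
    (innerSL ℝ : E →L[ℝ] E →L[ℝ] ℝ).hasFDerivAt
  rw [sphereHessian, e₂.fderiv_eq, ((d₁.fun_smul d₂).fun_add (d₃.hasFDerivAt.fun_smul d₄)).fderiv]
  simp [hx, hu, hv, sub_eq_add_neg]
  exact Or.inl rfl

theorem fderiv_smul_arg (hom : ∀ t : ℝ, 0 < t → ∀ x, h (t • x) = t * h x) {t : ℝ} (ht : 0 < t)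
    {x : E} (hx : x ≠ 0) : fderiv ℝ h (t • x) = fderiv ℝ h x := by
  rw [fderiv_smul_of_homogeneous ht.ne' (c := t) (fun y _ => by rw [hom t ht, smul_eq_mul]) hx,
    inv_mul_cancel₀ ht.ne', one_smul]

theorem fderiv_apply_self (hsm : ContDiffOn ℝ ∞ h {0}ᶜ)
    (hom : ∀ t : ℝ, 0 < t → ∀ x, h (t • x) = t * h x) {x : E} (hx : x ≠ 0) :
    fderiv ℝ h x x = h x := by
  simpa using fderiv_apply_self_of_homogeneous
    ((contDiffAt_of_smooth hsm hx).differentiableAt (by simp)) (hasDerivAt_id (1 : ℝ))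
    (fun t ht => hom t ht x)

theorem fderiv_fderiv_apply_self (hsm : ContDiffOn ℝ ∞ h {0}ᶜ)
    (hom : ∀ t : ℝ, 0 < t → ∀ x, h (t • x) = t * h x) {x : E} (hx : x ≠ 0) :
    fderiv ℝ (fderiv ℝ h) x x = 0 := by
  simpa using fderiv_apply_self_of_homogeneous
    ((contDiffAt_fderiv_of_smooth hsm hx).differentiableAt (by simp))
    (hasDerivAt_const (1 : ℝ) (1 : ℝ))
    (fun t ht => by rw [fderiv_smul_arg hom ht hx, one_smul])

theorem fderiv_fderiv_symm (hsm : ContDiffOn ℝ ∞ h {0}ᶜ) {x : E} (hx : x ≠ 0) (u v : E) :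
    fderiv ℝ (fderiv ℝ h) x u v = fderiv ℝ (fderiv ℝ h) x v u := by
  have h2 : ContDiffAt ℝ 2 h x :=
    (contDiffAt_of_smooth hsm hx).of_le two_le_infty
  exact h2.isSymmSndFDerivAt (by simp) u v

variable [FiniteDimensional ℝ E]

/-- The `1`-homogeneous extension of the map sending a unit normal to the point of the boundary
with this normal. -/
noncomputable def normalMap (h : E → ℝ) (x : E) : E :=
  ‖x‖ • gradient h x

theorem normalMap_smul (hom : ∀ t : ℝ, 0 < t → ∀ x, h (t • x) = t * h x) {t : ℝ} (ht : 0 < t)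
    {x : E} (hx : x ≠ 0) : normalMap h (t • x) = t • normalMap h x := by
  rw [normalMap, normalMap, gradient, gradient, fderiv_smul_arg hom ht hx, norm_smul,
    Real.norm_eq_abs, abs_of_pos ht, mul_smul]

theorem fderiv_normalMap_smul (hom : ∀ t : ℝ, 0 < t → ∀ x, h (t • x) = t * h x) {t : ℝ}
    (ht : 0 < t) {x : E} (hx : x ≠ 0) :
    fderiv ℝ (normalMap h) (t • x) = fderiv ℝ (normalMap h) x := by
  rw [fderiv_smul_of_homogeneous ht.ne' (c := t) (fun y hy => normalMap_smul hom ht hy) hx,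
    inv_mul_cancel₀ ht.ne', one_smul]

theorem contDiffAt_gradient (hsm : ContDiffOn ℝ ∞ h {0}ᶜ) {x : E} (hx : x ≠ 0) :
    ContDiffAt ℝ ∞ (gradient h) x :=
  ((InnerProductSpace.toDual ℝ E).symm.contDiff.contDiffAt).comp x
    (contDiffAt_fderiv_of_smooth hsm hx)

theorem contDiffAt_normalMap (hsm : ContDiffOn ℝ ∞ h {0}ᶜ) {x : E} (hx : x ≠ 0) :
    ContDiffAt ℝ ∞ (normalMap h) x :=
  (contDiffAt_norm ℝ hx).smul (contDiffAt_gradient hsm hx)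

theorem inner_fderiv_normalMap (hsm : ContDiffOn ℝ ∞ h {0}ᶜ) {x : E} (hx : ‖x‖ = 1) (v w : E) :
    ⟪fderiv ℝ (normalMap h) x v, w⟫_ℝ =
      fderiv ℝ (fderiv ℝ h) x v w + ⟪x, v⟫_ℝ * fderiv ℝ h x w := by
  have h0 : x ≠ 0 := ne_zero_of_norm_ne_zero (by simp [hx])
  have hg : DifferentiableAt ℝ (gradient h) x :=
    (contDiffAt_gradient hsm h0).differentiableAt (by simp)
  have e : ⟪fderiv ℝ (gradient h) x v, w⟫_ℝ = fderiv ℝ (fderiv ℝ h) x v w := by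
    have h1 := fderiv_inner_apply ℝ hg (differentiableAt_const w) v
    have h2 := (((contDiffAt_fderiv_of_smooth hsm h0).differentiableAt
      (by simp)).hasFDerivAt.clm_apply (hasFDerivAt_const w x)).fderiv
    simp only [inner_gradient_left, h2] at h1
    simpa using h1.symm
  have h3 := ((hasFDerivAt_norm h0).fun_smul hg.hasFDerivAt).fderiv
  rw [show normalMap h = fun y => ‖y‖ • gradient h y from rfl, h3]
  simp [hx, inner_add_left, inner_smul_left, inner_gradient_left, e]

/-- The Hessian term dies because `D²h` annihilates `x`, and Euler's relation turns `dh(x)` into `h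
x`. Thus `DΨ` preserves `x^⊥` and acts as `h x` on the quotient, which yields both the determinant
and the radial part of the inverse. -/
theorem inner_self_fderiv_normalMap (hsm : ContDiffOn ℝ ∞ h {0}ᶜ)
    (hom : ∀ t : ℝ, 0 < t → ∀ x, h (t • x) = t * h x) {x : E} (hx : ‖x‖ = 1) (v : E) :
    ⟪x, fderiv ℝ (normalMap h) x v⟫_ℝ = h x * ⟪x, v⟫_ℝ := by
  have h0 : x ≠ 0 := ne_zero_of_norm_ne_zero (by simp [hx])
  rw [real_inner_comm, inner_fderiv_normalMap hsm hx, fderiv_fderiv_symm hsm h0,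
    fderiv_fderiv_apply_self hsm hom h0, fderiv_apply_self hsm hom h0]
  simp [mul_comm]

/-- The determinant of an operator which leaves `x^⊥` invariant and acts by multiplication by `c`
on the quotient by `x^⊥`. -/
theorem det_eq_mul_det_of_inner {M : E →L[ℝ] E} {x : E} (hx : ‖x‖ = 1) {c : ℝ}
    (hM : ∀ v, ⟪x, M v⟫_ℝ = c * ⟪x, v⟫_ℝ) {ι : Type*} [Fintype ι] [DecidableEq ι]
    (b : OrthonormalBasis ι ℝ (tangent x)) :
    M.det = c * (Matrix.of fun i j => ⟪M (b i), (b j : E)⟫_ℝ).det := by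
  have hT : tangent x ≤ (tangent x).comap (M : E →ₗ[ℝ] E) := by
    intro v hv
    rw [Submodule.mem_orthogonal_singleton_iff_inner_right] at hv
    rw [Submodule.mem_comap, Submodule.mem_orthogonal_singleton_iff_inner_right]
    simp [hM, hv]
  rw [ContinuousLinearMap.det, LinearMap.det_eq_det_mul_det (tangent x) _ hT, mul_comm]
  congr 1
  · have hq : (tangent x).mapQ (tangent x) (M : E →ₗ[ℝ] E) hT = c • LinearMap.id := by
      ext v
      simp only [LinearMap.comp_apply, Submodule.mkQ_apply, Submodule.mapQ_apply,
        LinearMap.smul_apply, LinearMap.id_apply]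
      rw [← Submodule.Quotient.mk_smul, Submodule.Quotient.eq,
        Submodule.mem_orthogonal_singleton_iff_inner_right]
      simp [inner_sub_right, inner_smul_right, hM]
    have hfr : finrank ℝ (E ⧸ tangent x) = 1 := by
      have h1 := Submodule.finrank_quotient_add_finrank (tangent x)
      have h2 := Submodule.finrank_add_finrank_orthogonal (ℝ ∙ x)
      rw [finrank_span_singleton (ne_zero_of_norm_ne_zero (by simp [hx]))] at h2
      have h3 : finrank ℝ (tangent x) = finrank ℝ ((ℝ ∙ x)ᗮ : Submodule ℝ E) := rfl
      omega
    rw [hq, LinearMap.det_smul, hfr]; simp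
  · rw [← LinearMap.det_toMatrix b.toBasis, ← Matrix.det_transpose]
    congr 1
    ext i j
    simp only [Matrix.transpose_apply, LinearMap.toMatrix_apply, Matrix.of_apply,
      OrthonormalBasis.coe_toBasis_repr_apply, OrthonormalBasis.coe_toBasis,
      OrthonormalBasis.repr_apply_apply]
    rw [real_inner_comm]
    rfl

end Homogeneous

/-! ### The normal map of a convex body -/

section SupportFunction

open Module Set

variable {E : Type*} [NormedAddCommGroup E] [InnerProductSpace ℝ E] {K : Set E}

theorem integrable_sphere_of_continuous [FiniteDimensional ℝ E] [MeasurableSpace E] [BorelSpace E]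
    {F : Type*} [NormedAddCommGroup F] {μ : Measure (Metric.sphere (0 : E) 1)} [IsFiniteMeasure μ]
    {f : Metric.sphere (0 : E) 1 → F} (hf : Continuous f) : Integrable f μ :=
  hf.integrable_of_hasCompactSupport (HasCompactSupport.of_compactSpace _)

instance [FiniteDimensional ℝ E] [MeasurableSpace E] [BorelSpace E] :
    IsFiniteMeasure (sphereMeasure E) := by
  unfold sphereMeasure; infer_instance

theorem supportFunction_smul (K : Set E) {t : ℝ} (ht : 0 < t) (x : E) :
    supportFunction K (t • x) = t * supportFunction K x := by
  rw [supportFunction, supportFunction, ← smul_eq_mul, ← Real.sSup_smul_of_nonneg ht.le,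
    ← Set.image_smul, Set.image_image]
  simp only [inner_smul_left, RCLike.conj_to_real, smul_eq_mul]

theorem supportFunction_pos (hK : IsCompact K) (h0 : (0 : E) ∈ interior K) {x : E} (hx : x ≠ 0) :
    0 < supportFunction K x := by
  obtain ⟨r, hr, hrK⟩ := Metric.mem_nhds_iff.1 (mem_interior_iff_mem_nhds.1 h0)
  have hn : 0 < ‖x‖ := norm_pos_iff.2 hx
  have hmem : (r / 2 / ‖x‖) • x ∈ K := hrK <| by
    rw [mem_ball_zero_iff, norm_smul, Real.norm_eq_abs, abs_of_pos (by positivity),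
      div_mul_cancel₀ _ hn.ne']
    linarith
  have hb : BddAbove ((fun y => ⟪x, y⟫_ℝ) '' K) :=
    (hK.image (by fun_prop)).bddAbove
  refine lt_of_lt_of_le ?_ (le_csSup hb ⟨_, hmem, rfl⟩)
  simp only [inner_smul_right, real_inner_self_eq_norm_sq]
  positivity

namespace IsSmoothStrictlyConvexBody

theorem continuous_supportFunction_sphere (hK : IsSmoothStrictlyConvexBody K) :
    Continuous fun x : Metric.sphere (0 : E) 1 => supportFunction K x :=
  hK.smooth.continuousOn.comp_continuous continuous_subtype_val
    fun _ => ne_zero_of_norm_ne_zero (by simp)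

theorem continuous_supportFunction_rpow_sphere (hK : IsSmoothStrictlyConvexBody K)
    (h0 : (0 : E) ∈ interior K) (q : ℝ) :
    Continuous fun x : Metric.sphere (0 : E) 1 => supportFunction K x ^ q :=
  hK.continuous_supportFunction_sphere.rpow_const fun _ =>
    Or.inl (supportFunction_pos hK.isCompact h0 (ne_zero_of_norm_ne_zero (by simp))).ne'

theorem curvatureForm_eq [FiniteDimensional ℝ E] (hK : IsSmoothStrictlyConvexBody K) {x : E}
    (hx : ‖x‖ = 1) (u v : tangent x) :
    curvatureForm K x u v = ⟪fderiv ℝ (normalMap (supportFunction K)) x u, (v : E)⟫_ℝ := by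
  rw [curvatureForm, sphereHessian_eq hK.smooth (fun t ht x => supportFunction_smul K ht x) hx,
    inner_fderiv_normalMap hK.smooth hx,
    Submodule.mem_orthogonal_singleton_iff_inner_right.1 u.2]
  ring

variable [FiniteDimensional ℝ E]

/-- The quotient by `x^⊥` contributes the factor `h`, and on `x^⊥` the matrix of `DΨ` is that of the
curvature form, with determinant `1 / 𝒦`. -/
theorem det_fderiv_normalMap (hK : IsSmoothStrictlyConvexBody K) {x : E} (hx : ‖x‖ = 1) :
    (fderiv ℝ (normalMap (supportFunction K)) x).det =
      supportFunction K x / gaussCurvature K x := by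
  rw [det_eq_mul_det_of_inner hx (inner_self_fderiv_normalMap hK.smooth
    (fun t ht x => supportFunction_smul K ht x) hx) (stdOrthonormalBasis ℝ (tangent x))]
  simp [gaussCurvature, hK.curvatureForm_eq hx]

/-- The tangent bases in `gaussCurvature` are chosen pointwise, without continuity; the basis-free
`det DΨ` avoids them. -/
theorem continuous_supportFunction_div_gaussCurvature (hK : IsSmoothStrictlyConvexBody K) :
    Continuous fun x : Metric.sphere (0 : E) 1 => supportFunction K x / gaussCurvature K x := by
  have h1 : ContinuousOn (fderiv ℝ (normalMap (supportFunction K))) {0}ᶜ :=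
    fun x hx => (((contDiffAt_normalMap hK.smooth hx).fderiv_right (m := 0)
      (by simp)).continuousAt).continuousWithinAt
  refine (ContinuousLinearMap.continuous_det.comp (h1.comp_continuous continuous_subtype_val
    fun _ => ne_zero_of_norm_ne_zero (by simp))).congr fun x => ?_
  exact hK.det_fderiv_normalMap (by simp)

theorem isUnit_fderiv_normalMap (hK : IsSmoothStrictlyConvexBody K)
    (h0 : (0 : E) ∈ interior K) {x : E} (hx : x ≠ 0) :
    IsUnit (fderiv ℝ (normalMap (supportFunction K)) x) := by
  wlog hx1 : ‖x‖ = 1 generalizing x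
  · have hn : 0 < ‖x‖ := norm_pos_iff.2 hx
    have := this (x := ‖x‖⁻¹ • x) (by simp [hx]) (by rw [norm_smul]; simp [hx])
    rwa [fderiv_normalMap_smul (fun t ht x => supportFunction_smul K ht x)
      (inv_pos.2 hn) hx] at this
  set M := fderiv ℝ (normalMap (supportFunction K)) x with hM
  -- A kernel vector is tangent because `h x ≠ 0`, and then positive definiteness of the curvature
  -- form forces it to vanish.
  have hinj : Function.Injective M := by
    rw [injective_iff_map_eq_zero]
    intro v hv
    have h1 := inner_self_fderiv_normalMap hK.smooth
      (fun t ht x => supportFunction_smul K ht x) hx1 v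
    rw [← hM, hv, inner_zero_right, eq_comm, mul_eq_zero] at h1
    have hvT : v ∈ tangent x := Submodule.mem_orthogonal_singleton_iff_inner_right.2
      (h1.resolve_left (supportFunction_pos hK.isCompact h0 hx).ne')
    by_contra hne
    have h2 := hK.posDef x hx1 ⟨v, hvT⟩ (by simpa [Subtype.ext_iff] using hne)
    rw [hK.curvatureForm_eq hx1, ← hM] at h2
    simp [hv] at h2
  rw [ContinuousLinearMap.isUnit_iff_bijective]
  exact ⟨hinj, LinearMap.surjective_of_injective (f := (M : E →ₗ[ℝ] E)) hinj⟩

/-- The radial part of `DΨ⁻¹` is division by `h`, which cancels the `h` in `det DΨ = h / 𝒦`. -/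
theorem inner_cofactorField (hK : IsSmoothStrictlyConvexBody K)
    (h0 : (0 : E) ∈ interior K) (A : E →L[ℝ] E) {x : E} (hx : ‖x‖ = 1) :
    ⟪x, cofactorField (normalMap (supportFunction K)) A x⟫_ℝ =
      (gaussCurvature K x)⁻¹ * ⟪x, A (gradient (supportFunction K) x)⟫_ℝ := by
  have hx0 : x ≠ 0 := ne_zero_of_norm_ne_zero (by simp [hx])
  have hU := hK.isUnit_fderiv_normalMap h0 hx0
  have hpos := supportFunction_pos hK.isCompact h0 hx0
  have h1 := inner_self_fderiv_normalMap hK.smooth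
    (fun t ht x => supportFunction_smul K ht x) hx
    (Ring.inverse (fderiv ℝ (normalMap (supportFunction K)) x)
      (A (normalMap (supportFunction K) x)))
  rw [← mul_apply_eq_comp, Ring.mul_inverse_cancel _ hU,
    one_apply_eq_self] at h1
  rw [cofactorField, inner_smul_right, hK.det_fderiv_normalMap hx, div_mul_eq_mul_div, ← h1,
    normalMap, hx, one_smul, mul_comm, div_eq_mul_inv, mul_comm]

/-! ### The two integral identities on the sphere -/

variable [MeasurableSpace E] [BorelSpace E]

/-- The divergence theorem for a trace-free linear field on `K`, written on the sphere of
unit normals. -/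
theorem integral_inv_gaussCurvature_mul (hK : IsSmoothStrictlyConvexBody K)
    (h0 : (0 : E) ∈ interior K) [Nontrivial E] {A : E →L[ℝ] E}
    (hA : LinearMap.trace ℝ E A = 0) :
    ∫ x : Metric.sphere (0 : E) 1, (gaussCurvature K x)⁻¹ *
      ⟪(x : E), A (gradient (supportFunction K) x)⟫_ℝ ∂sphereMeasure E = 0 := by
  set Ψ := normalMap (supportFunction K) with hΨ
  set d : ℝ := (finrank ℝ E : ℝ) with hd
  have hd0 : 0 < finrank ℝ E := finrank_pos
  have hom := fun (t : ℝ) (ht : 0 < t) (x : E) => supportFunction_smul K ht x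
  have hW : ∀ x : E, x ≠ 0 → ContDiffAt ℝ 1 (cofactorField Ψ A) x := fun x hx =>
    contDiffAt_cofactorField A ((contDiffAt_normalMap hK.smooth hx).of_le
      two_le_infty) (hK.isUnit_fderiv_normalMap h0 hx)
  -- The cofactor field is 1-homogeneous, so `‖x‖ ^ (-d)` brings it to the required degree `1 - d`.
  -- It is divergence-free, so only the derivative of this weight survives.
  have key := integral_sphere_divergence_eq_zero
    (Y := fun x => ‖x‖ ^ (-d) • cofactorField Ψ A x)
    (fun x hx => ((contDiffAt_norm_rpow (-d) hx).smul (hW x hx)).contDiffWithinAt) (by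
      intro t ht x hx
      rw [cofactorField, cofactorField, fderiv_normalMap_smul hom ht hx, hΨ,
        normalMap_smul hom ht hx, map_smul, map_smul, norm_smul, Real.norm_eq_abs, abs_of_pos ht,
        Real.mul_rpow ht.le (norm_nonneg _), smul_comm _ t, smul_smul, smul_smul, smul_smul,
        smul_smul]
      congr 1
      rw [Real.rpow_neg ht.le, hd, Real.rpow_natCast]
      obtain ⟨k, hk⟩ : ∃ k, finrank ℝ E = k + 1 := ⟨_, (Nat.sub_add_cancel hd0).symm⟩
      rw [hk, Nat.add_sub_cancel, pow_succ]
      field_simp)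
  have hdiv : ∀ x : Metric.sphere (0 : E) 1,
      divergence (fun x => ‖x‖ ^ (-d) • cofactorField Ψ A x) x =
        -d * ((gaussCurvature K x)⁻¹ * ⟪(x : E), A (gradient (supportFunction K) x)⟫_ℝ) := by
    intro x
    have hx : ‖(x : E)‖ = 1 := by simp
    have hx0 : (x : E) ≠ 0 := ne_zero_of_norm_ne_zero (by simp)
    rw [divergence_smul ((contDiffAt_norm_rpow (m := 1) (-d) hx0).differentiableAt one_ne_zero)
      ((hW x hx0).differentiableAt one_ne_zero), fderiv_norm_rpow_apply _ hx,
      divergence_cofactorField A ((contDiffAt_normalMap hK.smooth hx0).of_le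
      two_le_infty) (hK.isUnit_fderiv_normalMap h0 hx0), hA,
      hK.inner_cofactorField h0 A hx]
    ring
  simp_rw [hdiv, integral_const_mul] at key
  exact (mul_eq_zero.1 key).resolve_left (by simp [hd, hd0.ne'])

/-- The field `‖x‖ ^ (-d - p) h ^ p • B x` has degree `1 - d`. Differentiating `h ^ p` gives the
left side and differentiating the norm weight the right side, while `B` itself has zero divergence.
-/
theorem integral_rpow_mul_inner (hK : IsSmoothStrictlyConvexBody K)
    (h0 : (0 : E) ∈ interior K) [Nontrivial E] {B : E →L[ℝ] E}
    (hB : LinearMap.trace ℝ E B = 0) (p : ℝ) :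
    p * ∫ x : Metric.sphere (0 : E) 1, supportFunction K x ^ (p - 1) *
        fderiv ℝ (supportFunction K) x (B x) ∂sphereMeasure E =
      (finrank ℝ E + p) * ∫ x : Metric.sphere (0 : E) 1, supportFunction K x ^ p *
        ⟪(x : E), B x⟫_ℝ ∂sphereMeasure E := by
  set h := supportFunction K with hh
  set d : ℝ := (finrank ℝ E : ℝ) with hd
  have hd0 : 0 < finrank ℝ E := finrank_pos
  have hpos : ∀ x : E, x ≠ 0 → 0 < h x := fun x hx => supportFunction_pos hK.isCompact h0 hx
  have hf : ∀ x : E, x ≠ 0 → ContDiffAt ℝ 1 (fun y => ‖y‖ ^ (-d - p) * h y ^ p) x := fun x hx =>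
    (contDiffAt_norm_rpow _ hx).mul
      (((contDiffAt_of_smooth hK.smooth hx).of_le (by simp)).rpow_const_of_ne (hpos x hx).ne')
  have key := integral_sphere_divergence_eq_zero
    (Y := fun x => (‖x‖ ^ (-d - p) * h x ^ p) • B x)
    (fun x hx => ((hf x hx).smul B.contDiff.contDiffAt).contDiffWithinAt) (by
      intro t ht x hx
      rw [hh, supportFunction_smul K ht, map_smul, norm_smul, Real.norm_eq_abs, abs_of_pos ht,
        Real.mul_rpow ht.le (norm_nonneg _), Real.mul_rpow ht.le (hpos x hx).le, smul_smul,
        smul_smul]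
      congr 1
      have e : t ^ (-d - p) * t ^ p * t = (t ^ (finrank ℝ E - 1))⁻¹ := by
        rw [← Real.rpow_add ht, sub_add_cancel, Real.rpow_neg ht.le, hd, Real.rpow_natCast]
        obtain ⟨k, hk⟩ : ∃ k, finrank ℝ E = k + 1 := ⟨_, (Nat.sub_add_cancel hd0).symm⟩
        rw [hk, Nat.add_sub_cancel, pow_succ]
        field_simp
      rw [← e]
      ring)
  have hdiv : ∀ x : Metric.sphere (0 : E) 1,
      divergence (fun x => (‖x‖ ^ (-d - p) * h x ^ p) • B x) x =
        p * (h x ^ (p - 1) * fderiv ℝ h x (B x)) - (d + p) * (h x ^ p * ⟪(x : E), B x⟫_ℝ) := by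
    intro x
    have hx : ‖(x : E)‖ = 1 := by simp
    have hx0 : (x : E) ≠ 0 := ne_zero_of_norm_ne_zero (by simp)
    have h1 := ((contDiffAt_norm_rpow (m := 1) (-d - p) hx0).differentiableAt
      one_ne_zero).hasFDerivAt
    have h2 := ((contDiffAt_of_smooth hK.smooth hx0).differentiableAt
      (by simp)).hasFDerivAt.rpow_const (p := p) (Or.inl (hpos x hx0).ne')
    rw [divergence_smul ((hf x hx0).differentiableAt one_ne_zero) B.differentiableAt,
      divergence_clm, hB, (h1.fun_mul h2).fderiv]
    simp only [add_apply, smul_apply, fderiv_norm_rpow_apply _ hx, hx,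
      Real.one_rpow, smul_eq_mul]
    ring
  have hcr := hK.continuous_supportFunction_rpow_sphere h0
  have hcd : Continuous fun x : Metric.sphere (0 : E) 1 => fderiv ℝ h x :=
    (hK.smooth.continuousOn_fderiv_of_isOpen isOpen_compl_singleton (by simp)).comp_continuous
      continuous_subtype_val fun _ => ne_zero_of_norm_ne_zero (by simp)
  simp_rw [hdiv] at key
  rw [integral_sub, integral_const_mul, integral_const_mul, sub_eq_zero] at key
  · exact key
  · exact integrable_sphere_of_continuous (continuous_const.mul ((hcr _).mul (hcd.clm_apply
      (B.continuous.comp continuous_subtype_val))))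
  · exact integrable_sphere_of_continuous (continuous_const.mul ((hcr _).mul (continuous_subtype_val.inner
      (B.continuous.comp continuous_subtype_val))))

end IsSmoothStrictlyConvexBody

end SupportFunction

/-! ### Combining the identities: isotropy of the cone-volume measure -/

section Isotropy

open Module Set

variable {E : Type*} [NormedAddCommGroup E] [InnerProductSpace ℝ E] {K : Set E}
  [FiniteDimensional ℝ E]

theorem trace_adjoint (B : E →L[ℝ] E) :
    LinearMap.trace ℝ E (ContinuousLinearMap.adjoint B : E →L[ℝ] E) = LinearMap.trace ℝ E B := by
  rw [LinearMap.trace_eq_sum_inner _ (stdOrthonormalBasis ℝ E),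
    LinearMap.trace_eq_sum_inner _ (stdOrthonormalBasis ℝ E)]
  refine Finset.sum_congr rfl fun i _ => ?_
  simp [ContinuousLinearMap.adjoint_inner_right, real_inner_comm]

variable [MeasurableSpace E] [BorelSpace E]

namespace IsSmoothStrictlyConvexBody

theorem inv_gaussCurvature_ae_eq (hK : IsSmoothStrictlyConvexBody K)
    (h0 : (0 : E) ∈ interior K) {p : ℝ}
    (hV : weightedConeMeasure K = (sphereMeasure E).withDensity
      fun x => ENNReal.ofReal (supportFunction K x ^ p)) :
    ∀ᵐ x : Metric.sphere (0 : E) 1 ∂sphereMeasure E,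
      (gaussCurvature K x)⁻¹ = supportFunction K x ^ (p - 1) := by
  have h1 := (withDensity_eq_iff_of_sigmaFinite
    hK.continuous_supportFunction_div_gaussCurvature.measurable.ennreal_ofReal.aemeasurable
    (hK.continuous_supportFunction_rpow_sphere h0 p).measurable.ennreal_ofReal.aemeasurable).1 hV
  filter_upwards [h1] with x hx
  have hpos := supportFunction_pos hK.isCompact h0 (x := (x : E))
    (ne_zero_of_norm_ne_zero (by simp))
  have hq := Real.rpow_pos_of_pos hpos p
  -- `ENNReal.ofReal` truncates negative values, so positivity of the quotient has to be read off
  -- from `h ^ p > 0` before the densities can be compared as reals.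
  have hquot : 0 < supportFunction K x / gaussCurvature K x := by
    rw [← ENNReal.ofReal_pos, hx, ENNReal.ofReal_pos]
    exact hq
  rw [ENNReal.ofReal_eq_ofReal_iff hquot.le hq.le] at hx
  rw [Real.rpow_sub_one hpos.ne', ← hx]
  field_simp

/-- The quadratic moments of `h ^ p` against trace-free operators vanish if the cone-volume
measure of `K` has density `h ^ p`. -/
theorem integral_rpow_mul_inner_eq_zero (hK : IsSmoothStrictlyConvexBody K)
    (h0 : (0 : E) ∈ interior K) [Nontrivial E] {p : ℝ} (hp : (finrank ℝ E : ℝ) + p ≠ 0)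
    (hV : weightedConeMeasure K = (sphereMeasure E).withDensity
      fun x => ENNReal.ofReal (supportFunction K x ^ p))
    {B : E →L[ℝ] E} (hB : LinearMap.trace ℝ E B = 0) :
    ∫ x : Metric.sphere (0 : E) 1, supportFunction K x ^ p * ⟪(x : E), B x⟫_ℝ
      ∂sphereMeasure E = 0 := by
  -- The adjoint is chosen so that `⟪x, A ∇h⟫ = dh(B x)`.
  have h1 := hK.integral_inv_gaussCurvature_mul h0 (A := ContinuousLinearMap.adjoint B)
    (by rw [trace_adjoint, hB])
  have h2 := hK.integral_rpow_mul_inner h0 hB p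
  have h3 : ∫ x : Metric.sphere (0 : E) 1, supportFunction K x ^ (p - 1) *
      fderiv ℝ (supportFunction K) x (B x) ∂sphereMeasure E = 0 := by
    rw [← h1]
    refine integral_congr_ae ?_
    filter_upwards [hK.inv_gaussCurvature_ae_eq h0 hV] with x hx
    rw [hx, ContinuousLinearMap.adjoint_inner_right, real_inner_comm, inner_gradient_left]
  rw [h3, mul_zero, eq_comm, mul_eq_zero] at h2
  exact h2.resolve_left hp

theorem integral_rankOne_eq (hK : IsSmoothStrictlyConvexBody K)
    (h0 : (0 : E) ∈ interior K) [Nontrivial E] {p : ℝ} (hp : (finrank ℝ E : ℝ) + p ≠ 0)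
    (hV : weightedConeMeasure K = (sphereMeasure E).withDensity
      fun x => ENNReal.ofReal (supportFunction K x ^ p)) :
    Integrable (fun x : Metric.sphere (0 : E) 1 =>
        InnerProductSpace.rankOne ℝ (x : E) (x : E)) (weightedConeMeasure K) ∧
    ∫ x : Metric.sphere (0 : E) 1, InnerProductSpace.rankOne ℝ (x : E) (x : E)
        ∂(weightedConeMeasure K) =
      ((1 / (finrank ℝ E : ℝ)) * ∫ _ : Metric.sphere (0 : E) 1, (1 : ℝ)
          ∂(weightedConeMeasure K)) • ContinuousLinearMap.id ℝ E := by
  have hcont := hK.continuous_supportFunction_rpow_sphere h0 p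
  have hnn : ∀ x : Metric.sphere (0 : E) 1, 0 ≤ supportFunction K x ^ p := fun x =>
    (Real.rpow_pos_of_pos (supportFunction_pos hK.isCompact h0
      (ne_zero_of_norm_ne_zero (by simp))) p).le
  have : IsFiniteMeasure (weightedConeMeasure K) := by
    rw [hV]
    refine isFiniteMeasure_withDensity_ofReal ?_
    exact (integrable_sphere_of_continuous hcont).2
  have hintV : ∀ f : Metric.sphere (0 : E) 1 → ℝ, ∫ x, f x ∂weightedConeMeasure K =
      ∫ x, supportFunction K x ^ p * f x ∂sphereMeasure E := by
    intro f
    rw [hV, integral_withDensity_eq_integral_toReal_smul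
      hcont.measurable.ennreal_ofReal (.of_forall fun _ => ENNReal.ofReal_lt_top)]
    simp [ENNReal.toReal_ofReal (hnn _)]
  have hrc : Continuous fun x : Metric.sphere (0 : E) 1 =>
      InnerProductSpace.rankOne ℝ (x : E) (x : E) :=
    ((InnerProductSpace.rankOne ℝ).continuous.comp continuous_subtype_val).clm_apply
      continuous_subtype_val
  refine ⟨integrable_sphere_of_continuous hrc, ?_⟩
  ext1 w
  refine ext_inner_left ℝ fun z => ?_
  set d : ℝ := (finrank ℝ E : ℝ) with hd
  have hd0 : d ≠ 0 := by simp [hd, (finrank_pos (R := ℝ) (M := E)).ne']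
  -- The trace-free part of the rank-one operator `v ↦ ⟪w, v⟫ z`. On unit vectors its quadratic form
  -- is the `(w, z)` entry of `x ⊗ x` minus the constant `⟪w, z⟫ / d`.
  set B : E →L[ℝ] E := (innerSL ℝ w).smulRight z - (⟪w, z⟫_ℝ / d) • ContinuousLinearMap.id ℝ E
    with hBdef
  have hB : LinearMap.trace ℝ E B = 0 := by
    rw [hBdef, ContinuousLinearMap.toLinearMap_sub, map_sub, trace_smulRight,
      ContinuousLinearMap.toLinearMap_smul, map_smul, ContinuousLinearMap.coe_id,
      LinearMap.trace_id, smul_eq_mul, ← hd, div_mul_cancel₀ _ hd0, innerSL_apply_apply, sub_self]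
  have key := hK.integral_rpow_mul_inner_eq_zero h0 hp hV hB
  rw [← hintV] at key
  have hxB : ∀ x : Metric.sphere (0 : E) 1, ⟪(x : E), B x⟫_ℝ =
      ⟪(x : E), w⟫_ℝ * ⟪z, (x : E)⟫_ℝ - ⟪w, z⟫_ℝ / d * 1 := by
    intro x
    simp [hBdef, inner_sub_right, inner_smul_right, real_inner_comm]
  simp_rw [hxB] at key
  rw [integral_sub (integrable_sphere_of_continuous (by fun_prop)) (integrable_sphere_of_continuous continuous_const), integral_const_mul,
    sub_eq_zero] at key
  rw [ContinuousLinearMap.integral_apply (integrable_sphere_of_continuous hrc), ← integral_inner (integrable_sphere_of_continuous (by fun_prop))]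
  simp only [InnerProductSpace.rankOne_apply, inner_smul_right, key,
    smul_apply, ContinuousLinearMap.id_apply, real_inner_comm z w]
  ring

end IsSmoothStrictlyConvexBody

end Isotropy

end ConvexBodyGeometry

theorem mainTheorem5 (n : ℕ) (K : Set (EuclideanSpace ℝ (Fin (n + 1))))
    (hK : ConvexBodyGeometry.IsSmoothStrictlyConvexBody K)
    (h0 : (0 : EuclideanSpace ℝ (Fin (n + 1))) ∈ interior K)
    (p : ℝ) (hp : p ≠ -((n : ℝ) + 1))
    (hV : ConvexBodyGeometry.weightedConeMeasure K =
      (ConvexBodyGeometry.sphereMeasure (EuclideanSpace ℝ (Fin (n + 1)))).withDensity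
        fun x => ENNReal.ofReal (ConvexBodyGeometry.supportFunction K x ^ p)) :
    Integrable (fun x : Metric.sphere (0 : EuclideanSpace ℝ (Fin (n + 1))) 1 =>
        InnerProductSpace.rankOne ℝ (x : EuclideanSpace ℝ (Fin (n + 1)))
          (x : EuclideanSpace ℝ (Fin (n + 1))))
      (ConvexBodyGeometry.weightedConeMeasure K) ∧
    ∫ x : Metric.sphere (0 : EuclideanSpace ℝ (Fin (n + 1))) 1,
        InnerProductSpace.rankOne ℝ (x : EuclideanSpace ℝ (Fin (n + 1)))
          (x : EuclideanSpace ℝ (Fin (n + 1)))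
        ∂(ConvexBodyGeometry.weightedConeMeasure K) =
      ((1 / ((n : ℝ) + 1)) *
        ∫ _ : Metric.sphere (0 : EuclideanSpace ℝ (Fin (n + 1))) 1, (1 : ℝ)
          ∂(ConvexBodyGeometry.weightedConeMeasure K)) •
        ContinuousLinearMap.id ℝ (EuclideanSpace ℝ (Fin (n + 1))) := by
  have hfr : Module.finrank ℝ (EuclideanSpace ℝ (Fin (n + 1))) = n + 1 := by simp
  have h := hK.integral_rankOne_eq h0 (p := p) (by
    rw [hfr]
    push_cast
    exact fun h => hp (by linarith)) hV
  rw [hfr] at h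
  push_cast at h
  exact h
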